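/- Let $q$ be a prime power and let $n\ge 2$, $r$, $s$ be integers with $\lceil n/2\rceil\le r\le n-1$, $\gcd(n,r)=1$ and $1\le s<n-1$. Put $T_n(y)=y+y^q+\cdots+y^{q^{n-1}}$. A $q$-polynomial over $\mathbb{F}_{q^n}$ is a polynomial of the form $\sum_{i=0}^{\ell}a_iy^{q^i}$ with $a_i\in\mathbb{F}_{q^n}$. Let $g_s\in\mathbb{F}_{q^n}[y]$ be a monic $q$-polynomial of degree $q^s$ that splits into linear factors over $\mathbb{F}_{q^n}$ and satisfies $g_s(g(y))=T_n(y)$ for some monic $q$-polynomial $g\in\mathbb{F}_{q^n}[y]$. Let $\mathcal{X}_{n,r}^s$ be the curve over $\mathbb{F}_{q^n}$ with affine equation $$g_s(y)=x^{q^n+q^{n-r}}-x^{q^{n-r}+1}.$$ Then the affine coordinate ring of $\mathcal{X}_{n,r}^s$ is an integral domain, so that its fraction field is the function field $\mathbb{F}_{q^n}(\mathcal{X}_{n,r}^s)$; there is exactly one place $P_\infty$ of this function field lying over the point $(0:1:0)$ of the projective closure of $\mathcal{X}_{n,r}^s$; this place is rational (of degree one); and the pole divisors of the coordinate functions $x,y$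 are $$(x)_\infty=q^s\,P_\infty\qquad\text{and}\qquad (y)_\infty=(q^n+q^{n-r})\,P_\infty .$$ -/

import Mathlib

open Polynomial

noncomputable section

namespace SubcoverCurve

/-! ### `q`-polynomials -/

/-- `f` is a `q`-polynomial: `f = a_0 X + a_1 X^q + ⋯ + a_ℓ X^(q^ℓ)`. -/
def IsQPolynomial {K : Type*} [Field K] (q : ℕ) (f : K[X]) : Prop :=
  ∃ (l : ℕ) (a : ℕ → K), f = ∑ i ∈ Finset.range (l + 1), C (a i) * X ^ q ^ i

/-- `T_n = X + X^q + ⋯ + X^(q^(n-1))`. -/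
def tracePolynomial (K : Type*) [Field K] (q n : ℕ) : K[X] :=
  ∑ i ∈ Finset.range n, X ^ q ^ i

/-- The polynomials `g_s` used to define the curves: monic `q`-polynomials of degree `q^s` that
split into linear factors over `K` and satisfy `g_s(g(y)) = T_n(y)` for some monic `q`-polynomial
`g` over `K`. -/
structure IsSubcoverPolynomial {K : Type*} [Field K] (q n s : ℕ) (gs : K[X]) : Prop where
  isQPolynomial : IsQPolynomial q gs
  monic : gs.Monic
  natDegree_eq : gs.natDegree = q ^ s
  splits : gs.Splits
  exists_comp_eq : ∃ g : K[X], IsQPolynomial q g ∧ g.Monic ∧ gs.comp g = tracePolynomial K q n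

/-! ### The curve `g_s(y) = x^(q^n + q^(n-r)) - x^(q^(n-r) + 1)` and its function field -/

/-- The polynomial `g_s(Y) - (X^(q^n + q^(n-r)) - X^(q^(n-r) + 1))` in `K[X][Y]`. -/
def curvePolynomial {K : Type*} [Field K] (q n r : ℕ) (gs : K[X]) : K[X][X] :=
  gs.map C - C (X ^ (q ^ n + q ^ (n - r)) - X ^ (q ^ (n - r) + 1))

/-- The affine coordinate ring `K[X, Y] / (g_s(Y) - X^(q^n + q^(n-r)) + X^(q^(n-r) + 1))`. -/
abbrev CoordinateRing {K : Type*} [Field K] (q n r : ℕ) (gs : K[X]) : Type _ :=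
  AdjoinRoot (curvePolynomial q n r gs)

/-- The function field of the curve: the fraction ring of the affine coordinate ring (a field as
soon as the coordinate ring is a domain). -/
abbrev FunctionField {K : Type*} [Field K] (q n r : ℕ) (gs : K[X]) : Type _ :=
  FractionRing (CoordinateRing q n r gs)

/-- The coordinate function `x`. -/
def xFun {K : Type*} [Field K] (q n r : ℕ) (gs : K[X]) : FunctionField q n r gs :=
  algebraMap (CoordinateRing q n r gs) _ (AdjoinRoot.of (curvePolynomial q n r gs) X)

/-- The coordinate function `y`. -/
def yFun {K : Type*} [Field K] (q n r : ℕ) (gs : K[X]) : FunctionField q n r gs :=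
  algebraMap (CoordinateRing q n r gs) _ (AdjoinRoot.root (curvePolynomial q n r gs))

/-! ### Places, orders and pole divisors -/

/-- The places of a function field `F` over `K`, that is, the (closed) points of the nonsingular
projective model: the discrete valuation rings of `F` containing `K` with fraction field `F`. -/
structure Place (K F : Type*) [Field K] [Field F] [Algebra K F] where
  /-- The valuation ring of the place. -/
  ring : ValuationSubring F
  algebraMap_mem : ∀ c : K, algebraMap K F c ∈ ring
  isDVR : IsDiscreteValuationRing ring

namespace Place

variable {K F : Type*} [Field K] [Field F] [Algebra K F]

/-- The normalized discrete valuation of a place, written multiplicatively. -/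
def val (P : Place K F) : Valuation F (WithZero (Multiplicative ℤ)) :=
  haveI := P.isDVR
  (IsDiscreteValuationRing.maximalIdeal P.ring).valuation F

/-- The order `v_P(f)` of a nonzero `f` at `P` (with the convention `ord P 0 = 0`). -/
def ord (P : Place K F) (f : F) : ℤ := -WithZero.log (P.val f)

/-- `P` is rational, i.e. of degree one: its residue field is `K`. -/
def IsRational (P : Place K F) : Prop :=
  ∀ f ∈ P.ring, ∃ c : K, P.val (f - algebraMap K F c) < 1

/-- `P` lies over the point `(0 : 1 : 0)` of the projective closure of the plane curve with
affine coordinate functions `x, y`: in `(x : y : 1) = (x / y : 1 : 1 / y)`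
both `x / y` and `1 / y` vanish at `P`. -/
def LiesOverInfinity (P : Place K F) (x y : F) : Prop :=
  P.val x < P.val y ∧ 1 < P.val y

end Place

/-- Divisors: finite formal `ℤ`-linear combinations of places. -/
abbrev Divisor (K F : Type*) [Field K] [Field F] [Algebra K F] : Type _ := Place K F →₀ ℤ

/-- `D` is the pole divisor `(f)_∞ = ∑_{v_P(f) < 0} (-v_P(f)) P` of `f`. -/
def IsPoleDivisor {K F : Type*} [Field K] [Field F] [Algebra K F] (f : F) (D : Divisor K F) :
    Prop :=
  ∀ P : Place K F, D P = max 0 (-P.ord f)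

end SubcoverCurve

end

/-! Write u = n - r and let V be the group of roots of g_s in K. The derivative of g_s is a nonzero
constant, so g_s is the product of the X - v for v in V, and |V| = q^s. If y is one root of g_s(Y) =
f, the others are the y + v. So adjoining y to k = K(x) gives a Galois extension whose automorphisms
translate y by elements of V.

The core is total ramification, of index |V|, above the pole of x (`inertia_eq_top_and_card_eq`).
Suppose inertia realised only a proper subgroup U of V. Then g_s = h^p - d^(p-1) h with h invariant
under U (`exists_artinSchreier_decomposition`), and z = h(y) is fixed by inertia, so the valuation
at the pole of x extends with the same value group to a field containing z. But modulo w^p - w the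
equation for z has a right-hand side of degree q^r + 1 in x, because u < r. This degree is prime to
p, so p would divide the pole order of x (`dvd_log_valuation_of_artinSchreier`), which is 1.

Applied to any irreducible factor of the equation over k, total ramification forces that factor to
have full degree, hence irreducibility. Applied to the function field, it gives exactly one place
above the pole of x, with ramification index |V| and residue field K. Comparing valuations in g_s(y)
= f(x) then shows that x and y have the same poles and gives the pole order of y. -/

noncomputable section

namespace SubcoverCurve

open IsDedekindDomain WithZero

/-! ### Inertia groups and unramified subextensions -/

section Ramification

/-- A prime of an intermediate ring `C` of a Galois extension `B / A` is unramified over `A` if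
`C` is contained in the inertia ring of a prime `P` of `B` above it. -/
theorem ramificationIdx_eq_one_of_inertia_le {A B C G : Type*} [CommRing A] [IsDomain A]
    [CommRing B] [IsDomain B] [CommRing C] [IsDomain C] [Algebra A B] [Algebra A C] [Algebra C B]
    [IsScalarTower A C B] [Group G] [Finite G] [MulSemiringAction G B] [IsGaloisGroup G A B]
    [Module.Finite A B] [Module.Flat A B] [Module.Finite A C] [Module.Finite C B] [Module.Flat C B]
    (H : Subgroup G) [IsGaloisGroup H C B]
    (p : Ideal A) [p.IsMaximal] [Finite (A ⧸ p)] (c : Ideal C) [c.IsMaximal] (P : Ideal B)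
    [P.IsPrime] [P.LiesOver p] [P.LiesOver c] [c.LiesOver p]
    (hH : P.inertia G ≤ H) : c.ramificationIdx A = 1 := by
  have : Finite (C ⧸ c) := Module.finite_of_finite (A ⧸ p)
  have h1 := Ideal.card_inertia_eq_ramificationIdxIn (G := G) p P
  have h2 := Ideal.card_inertia_eq_ramificationIdxIn (G := H) c P
  rw [Ideal.ramificationIdxIn_eq_ramificationIdx p P G] at h1
  rw [Ideal.ramificationIdxIn_eq_ramificationIdx c P H] at h2
  -- As the inertia group lies in `H`, the indices of `P` over `A` and over `C` are the order of the
  -- same group; the tower formula leaves 1 for `c` over `A`.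
  have h3 : Nat.card (P.inertia H) = Nat.card (P.inertia G) :=
    Nat.card_congr (Subgroup.subgroupOfEquivOfLe hH).toEquiv
  have h4 := Ideal.ramificationIdx_tower (R := A) c P
  rw [← h1, ← h2, h3] at h4
  exact (right_eq_mul₀ Nat.card_pos.ne').1 h4

variable {A K L : Type*} [CommRing A] [IsDedekindDomain A] [Field K] [Field L] [Algebra A K]
  [IsFractionRing A K] [Algebra K L] [Algebra A L] [IsScalarTower A K L] [FiniteDimensional K L]
  [IsGalois K L]

/-- The valuation of `v` extends with value group unchanged to every subfield of `L` that is
contained in the inertia field of a prime above `v`. -/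
theorem exists_valuation_fixedField_of_inertia_le (v : HeightOneSpectrum A)
    [Finite (A ⧸ v.asIdeal)] (P : Ideal (integralClosure A L)) [P.IsPrime]
    [P.LiesOver v.asIdeal] (H : Subgroup Gal(L/K)) (hH : P.inertia Gal(L/K) ≤ H) :
    ∃ w : Valuation (IntermediateField.fixedField H) ℤᵐ⁰,
      ∀ a : K, w (algebraMap K _ a) = v.valuation K a := by
  let E := IntermediateField.fixedField H
  let B := integralClosure A L
  let C := integralClosure A E
  have : IsScalarTower A E L := IsScalarTower.of_algebraMap_eq fun _ => rfl
  let : Algebra C B := ((IsScalarTower.toAlgHom A E L).mapIntegralClosure).toAlgebra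
  have : IsScalarTower A C B :=
    IsScalarTower.of_algebraMap_eq fun a => Subtype.ext
      (IsScalarTower.algebraMap_apply A E L a)
  have : IsScalarTower C B L := IsScalarTower.of_algebraMap_eq fun _ => rfl
  have : IsScalarTower C E L := IsScalarTower.of_algebraMap_eq fun _ => rfl
  have : IsDedekindDomain C := IsIntegralClosure.isDedekindDomain A K E C
  have : IsDedekindDomain B := IsIntegralClosure.isDedekindDomain A K L B
  have : IsFractionRing C E := IsIntegralClosure.isFractionRing_of_finite_extension A K E C
  have : IsFractionRing B L := IsIntegralClosure.isFractionRing_of_finite_extension A K L B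
  have : Module.Finite A C := IsIntegralClosure.finite A K E C
  have : Module.Finite A B := IsIntegralClosure.finite A K L B
  have : Module.Finite C B := Module.Finite.right A C B
  have hAL : Function.Injective (algebraMap A L) := by
    rw [IsScalarTower.algebraMap_eq A K L]
    exact (algebraMap K L).injective.comp (IsFractionRing.injective A K)
  have hAB : Function.Injective (algebraMap A B) := fun a b hab => hAL (congrArg Subtype.val hab)
  have hCB : Function.Injective (algebraMap C B) := fun a b hab =>
    Subtype.ext ((algebraMap E L).injective (congrArg (algebraMap B L) hab))
  have hAC : Function.Injective (algebraMap A C) := by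
    rw [IsScalarTower.algebraMap_eq A C B, RingHom.coe_comp] at hAB
    exact Function.Injective.of_comp hAB
  have : Module.IsTorsionFree A C := Module.isTorsionFree_iff_algebraMap_injective.2 hAC
  have : Module.IsTorsionFree A B := Module.isTorsionFree_iff_algebraMap_injective.2 hAB
  have : Module.IsTorsionFree C B := Module.isTorsionFree_iff_algebraMap_injective.2 hCB
  have : IsGaloisGroup Gal(L/K) A B := .of_isFractionRing _ _ _ K L
  have : IsGaloisGroup H E L := IsGaloisGroup.subgroup Gal(L/K) K L H
  have : IsGaloisGroup H C B := .of_isFractionRing _ _ _ E L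
  have := v.isMaximal
  have hc0 : P.under C ≠ ⊥ := by
    have : (P.under C).LiesOver v.asIdeal := inferInstance
    exact Ideal.ne_bot_of_liesOver_of_ne_bot v.ne_bot _
  let c : HeightOneSpectrum C := ⟨P.under C, inferInstance, hc0⟩
  have : c.asIdeal.IsMaximal := c.isMaximal
  have : P.LiesOver c.asIdeal := inferInstanceAs (P.LiesOver (P.under C))
  have : c.asIdeal.LiesOver v.asIdeal := inferInstanceAs ((P.under C).LiesOver v.asIdeal)
  have he := ramificationIdx_eq_one_of_inertia_le H v.asIdeal c.asIdeal P hH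
  rw [← Ideal.ramificationIdx'_eq_ramificationIdx _ _ v.ne_bot] at he
  refine ⟨c.valuation E, fun a => ?_⟩
  rw [← HeightOneSpectrum.valuation_liesOver E v c a, he, pow_one]

end Ramification

/-! ### Additive polynomials and their Artin-Schreier decompositions -/

section AdditivePolynomials

variable {K : Type*} [Field K]

/-- The monic polynomial whose roots are the elements of a finite additive subgroup. -/
def vanishingPolynomial (W : AddSubgroup K) [Fintype W] : K[X] :=
  ∏ w : W, (X - C (w : K))

namespace vanishingPolynomial

variable (W : AddSubgroup K) [Fintype W]

theorem monic : (vanishingPolynomial W).Monic :=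
  monic_prod_of_monic _ _ fun _ _ => monic_X_sub_C _

theorem natDegree_eq : (vanishingPolynomial W).natDegree = Fintype.card W := by
  simp [vanishingPolynomial, natDegree_prod_of_monic, monic_X_sub_C]

theorem eval_eq_zero_iff (a : K) : (vanishingPolynomial W).eval a = 0 ↔ a ∈ W := by
  simp [vanishingPolynomial, eval_prod, Finset.prod_eq_zero_iff, sub_eq_zero]

theorem comp_X_add_C {w : K} (hw : w ∈ W) :
    (vanishingPolynomial W).comp (X + C w) = vanishingPolynomial W := by
  rw [vanishingPolynomial, prod_comp]
  refine Fintype.prod_equiv (Equiv.subRight (⟨w, hw⟩ : W)) _ _ fun u => ?_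
  simp only [sub_comp, X_comp, C_comp, Equiv.subRight_apply, AddSubgroup.coe_sub, map_sub]
  ring

/-- For fixed b, the polynomial h(X + b) - h(X) - h(b) has degree below |W|, since the leading terms
cancel, and it vanishes on W by translation invariance; hence it is zero. -/
theorem additive (a b : K) : (vanishingPolynomial W).eval (a + b) =
    (vanishingPolynomial W).eval a + (vanishingPolynomial W).eval b := by
  classical
  have hm := monic W
  set h := vanishingPolynomial W with hh
  have hcard : (W : Set K).toFinset.card = h.natDegree := by
    rw [hh, natDegree_eq, Set.toFinset_card]; rfl
  have key : h.comp (X + C b) - h - C (h.eval b) = 0 := by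
    refine eq_zero_of_degree_lt_of_eval_finset_eq_zero (W : Set K).toFinset ?_ ?_
    · rw [hcard, ← degree_eq_natDegree hm.ne_zero]
      have hmc : (h.comp (X + C b)).Monic := hm.comp_X_add_C b
      have hdeg : (h.comp (X + C b)).degree = h.degree := by
        rw [degree_eq_natDegree hmc.ne_zero, degree_eq_natDegree hm.ne_zero, natDegree_comp]
        simp
      refine lt_of_le_of_lt (degree_sub_le _ _) (max_lt ?_ ?_)
      · rw [← hdeg]
        exact degree_sub_lt_left hdeg hmc.ne_zero (by rw [hm.leadingCoeff, hmc.leadingCoeff])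
      · refine lt_of_le_of_lt degree_C_le ?_
        rw [degree_eq_natDegree hm.ne_zero, hh, natDegree_eq]
        exact_mod_cast Fintype.card_pos
    · intro w hw
      have hw : w ∈ W := by simpa using hw
      have h0 : (vanishingPolynomial W).eval w = 0 := (eval_eq_zero_iff W w).2 hw
      have h1 := congrArg (eval b) (comp_X_add_C W hw)
      simp only [eval_comp, eval_add, eval_X, eval_C] at h1
      simp [h0, eval_comp, add_comm w b, hh, h1]
  have := congrArg (eval a) key
  simp only [eval_sub, eval_comp, eval_add, eval_X, eval_C, eval_zero] at this
  linear_combination this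

end vanishingPolynomial

/-- A monic polynomial `g` vanishing exactly on a finite additive group `V` factors, for each
proper subgroup `U` of `V`, through an Artin-Schreier polynomial and a `U`-invariant one. -/
theorem exists_artinSchreier_decomposition [Finite K] (p : ℕ) [Fact p.Prime] [CharP K p]
    {U V : AddSubgroup K} (hUV : U < V) {g : K[X]} (hg : g.Monic)
    (hdeg : g.natDegree = Nat.card V) (hroot : ∀ v ∈ V, g.eval v = 0) :
    ∃ (h : K[X]) (d : K), d ≠ 0 ∧ (∀ w ∈ U, h.comp (X + C w) = h) ∧
      g = h ^ p - C (d ^ (p - 1)) * h := by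
  classical
  let : Algebra (ZMod p) K := ZMod.algebra K p
  obtain ⟨v₀, hv₀, hv₀U⟩ := SetLike.exists_of_lt hUV
  obtain ⟨l₀, hl₀, hUl⟩ := Submodule.exists_le_ker_of_notMem
    (p := AddSubgroup.toZModSubmodule p U) (v := v₀) (by simpa using hv₀U)
  -- Normalised so that l(v₀) = 1. Then V is the direct sum of the line through v₀ and W = V ∩ ker
  -- l, and W still contains U.
  let l : K →ₗ[ZMod p] ZMod p := (l₀ v₀)⁻¹ • l₀
  have hl1 : l v₀ = 1 := by simp [l, hl₀]
  have hlU : ∀ u ∈ U, l u = 0 := fun u hu => by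
    have : l₀ u = 0 := hUl (by simpa using hu)
    simp [l, this]
  let W : AddSubgroup K := V ⊓ l.toAddMonoidHom.ker
  have hmemW : ∀ a, a ∈ W ↔ a ∈ V ∧ l a = 0 := fun a => by
    simp [W, AddSubgroup.mem_inf, AddMonoidHom.mem_ker]
  have hsmulV : ∀ (c : ZMod p), c • v₀ ∈ V := fun c =>
    (AddSubgroup.toZModSubmodule p V).smul_mem c (by simpa using hv₀)
  have : Fintype W := Fintype.ofFinite _
  have hcard : Nat.card V = p * Nat.card W := by
    have e : V ≃ ZMod p × W :=
      { toFun := fun v => (l v, ⟨v - l v • v₀, (hmemW _).2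
          ⟨V.sub_mem v.2 (hsmulV _), by simp [hl1]⟩⟩)
        invFun := fun x => ⟨x.2 + x.1 • v₀, V.add_mem ((hmemW _).1 x.2.2).1 (hsmulV _)⟩
        left_inv := fun v => by simp
        right_inv := fun x => by
          have := ((hmemW _).1 x.2.2).2
          ext <;> simp [this, hl1] }
    rw [Nat.card_congr e, Nat.card_prod, Nat.card_zmod]
  let h := vanishingPolynomial W
  have hm : h.Monic := vanishingPolynomial.monic W
  have hhdeg : h.natDegree = Nat.card W := by
    rw [Nat.card_eq_fintype_card]; exact vanishingPolynomial.natDegree_eq W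
  let φ : K →+ K := AddMonoidHom.mk' (fun a => h.eval a) (vanishingPolynomial.additive W)
  -- The additive map h is linear over the prime field and kills W, so on V it factors through l.
  have hφ : ∀ v ∈ V, h.eval v = l v • h.eval v₀ := fun v hv => by
    have h1 : h.eval (v - l v • v₀) = 0 := (vanishingPolynomial.eval_eq_zero_iff W _).2
      ((hmemW _).2 ⟨V.sub_mem hv (hsmulV _), by simp [hl1]⟩)
    have h2 : φ (v - l v • v₀) = 0 := h1
    have h3 : φ (l v • v₀) = l v • φ v₀ := map_smul (φ.toZModLinearMap p) (l v) v₀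
    rw [map_sub, h3, sub_eq_zero] at h2
    exact h2
  have hd : h.eval v₀ ≠ 0 := fun h0 => by
    have := ((hmemW _).1 ((vanishingPolynomial.eval_eq_zero_iff W _).1 h0)).2
    simp [hl1] at this
  have hp := (Fact.out : p.Prime)
  refine ⟨h, h.eval v₀, hd, fun w hw => vanishingPolynomial.comp_X_add_C W
    ((hmemW w).2 ⟨hUV.le hw, hlU w hw⟩), ?_⟩
  have hWpos : 0 < Nat.card W := Nat.card_pos
  have hpm : (h ^ p).Monic := hm.pow p
  have hlow : (C (h.eval v₀ ^ (p - 1)) * h).degree < (h ^ p).degree := by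
    rw [degree_C_mul (pow_ne_zero _ hd), degree_eq_natDegree hm.ne_zero,
      degree_eq_natDegree hpm.ne_zero, natDegree_pow, hhdeg]
    exact_mod_cast lt_mul_of_one_lt_left hWpos hp.one_lt
  have hRm : (h ^ p - C (h.eval v₀ ^ (p - 1)) * h).Monic := hpm.sub_of_left hlow
  have hRdeg : (h ^ p - C (h.eval v₀ ^ (p - 1)) * h).degree = g.degree := by
    rw [degree_sub_eq_left_of_degree_lt hlow, degree_eq_natDegree hpm.ne_zero,
      degree_eq_natDegree hg.ne_zero, natDegree_pow, hhdeg, hdeg, hcard]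
  have : Fintype V := Fintype.ofFinite _
  -- Both sides are monic of degree |V|, and both vanish on V: there h = l(v) d with d = h(v₀) and
  -- l(v)^p = l(v).
  refine sub_eq_zero.1 (eq_zero_of_degree_lt_of_eval_finset_eq_zero (V : Set K).toFinset ?_ ?_)
  · have : (V : Set K).toFinset.card = g.natDegree := by
      rw [hdeg, Set.toFinset_card, Nat.card_eq_fintype_card]; rfl
    rw [this, ← degree_eq_natDegree hg.ne_zero]
    exact degree_sub_lt_left hRdeg.symm hg.ne_zero (by rw [hg.leadingCoeff, hRm.leadingCoeff])
  · intro v hv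
    have hv : v ∈ V := by simpa using hv
    have hl : (algebraMap (ZMod p) K (l v)) ^ p = algebraMap (ZMod p) K (l v) := by
      rw [← map_pow, ZMod.pow_card]
    have hd' : h.eval v₀ ^ p = h.eval v₀ ^ (p - 1) * h.eval v₀ := by
      rw [← pow_succ, Nat.sub_add_cancel hp.one_le]
    simp only [eval_sub, hroot v hv, eval_pow, eval_mul, eval_C, hφ v hv, Algebra.smul_def,
      mul_pow, hl]
    linear_combination (-(algebraMap (ZMod p) K (l v))) * hd'

end AdditivePolynomials

/-! ### Valuations of polynomial expressions and the Artin-Schreier obstruction -/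

section ValuationLemmas

variable {K F : Type*} [Field K] [Field F] [Algebra K F] (v : Valuation F ℤᵐ⁰)

/-- Nonzero elements of a finite field are roots of unity, and the value group is torsion-free. -/
theorem valuation_algebraMap_eq_one [Finite K] {c : K} (hc : c ≠ 0) :
    v (algebraMap K F c) = 1 := by
  have hu : IsOfFinOrder (Units.mk0 c hc) := isOfFinOrder_of_finite _
  obtain ⟨m, hm, h⟩ := isOfFinOrder_iff_pow_eq_one.1 hu
  have h : c ^ m = 1 := by simpa using congrArg Units.val h
  have h1 : v (algebraMap K F c) ^ m = 1 := by rw [← map_pow, ← map_pow, h, map_one, map_one]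
  exact (pow_eq_one_iff.1 h1).resolve_right hm.ne'

theorem valuation_algebraMap_le_one [Finite K] (c : K) : v (algebraMap K F c) ≤ 1 := by
  rcases eq_or_ne c 0 with rfl | hc
  · simp
  · exact (valuation_algebraMap_eq_one v hc).le

theorem valuation_aeval_le_one (hv : ∀ c : K, v (algebraMap K F c) ≤ 1) (g : K[X]) {z : F}
    (hz : v z ≤ 1) : v (aeval z g) ≤ 1 := by
  rw [aeval_eq_sum_range]
  refine v.map_sum_le fun i _ => ?_
  rw [Algebra.smul_def, map_mul, map_pow]
  exact mul_le_one' (hv _) (pow_le_one' hz _)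

/-- A monic polynomial over the constants is dominated by its leading term at a pole. -/
theorem valuation_aeval_of_one_lt (hv : ∀ c : K, v (algebraMap K F c) ≤ 1) {g : K[X]}
    (hg : g.Monic) {z : F} (hz : 1 < v z) : v (aeval z g) = v z ^ g.natDegree := by
  rw [hg.as_sum, map_add]
  simp only [map_sum, map_pow, aeval_X, map_mul, aeval_C]
  rw [← hg.as_sum, Valuation.map_add_eq_of_lt_left, map_pow]
  rw [map_pow]
  refine v.map_sum_lt (pow_ne_zero _ (zero_lt_one.trans hz).ne') fun i hi => ?_
  rw [map_mul, map_pow]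
  calc _ ≤ 1 * v z ^ i := by gcongr; exact hv _
    _ < _ := by rw [one_mul]; exact pow_lt_pow_right₀ hz (Finset.mem_range.1 hi)

theorem valuation_pow_sub_pow_of_one_lt {x : F} (hx : 1 < v x) {a b : ℕ} (hab : b < a) :
    v (x ^ a - x ^ b) = v x ^ a := by
  rw [v.map_sub_eq_of_lt_left (by simpa using pow_lt_pow_right₀ hx hab), map_pow]

end ValuationLemmas

/-- If the Artin-Schreier type equation `z ^ p - d ^ (p - 1) * z = x ^ (q ^ n + q ^ u) -
x ^ (q ^ u + 1)` has a solution, then `p` divides the order of every pole of `x`: modulo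
`w ^ p - w` the right-hand side has the prime-to-`p` degree `q ^ (n - u) + 1`. -/
theorem dvd_log_valuation_of_artinSchreier {K F : Type*} [Field K] [Finite K] [Field F]
    [Algebra K F] (p k u r : ℕ) [Fact p.Prime] [CharP K p] (hk : k ≠ 0) (hur : u < r)
    (v : Valuation F ℤᵐ⁰) {x z : F} {d : K} (hd : d ≠ 0) (hx : 1 < v x)
    (hz : z ^ p - algebraMap K F d ^ (p - 1) * z =
      x ^ ((p ^ k) ^ (u + r) + (p ^ k) ^ u) - x ^ ((p ^ k) ^ u + 1)) :
    (p : ℤ) ∣ log (v x) := by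
  have hp := (Fact.out : p.Prime)
  have : CharP F p := charP_of_injective_algebraMap (algebraMap K F).injective p
  have hv := valuation_algebraMap_le_one (K := K) v
  -- α is the q^u-th root of d^(-p), where q = p^k. Thus e = α x^(q^r + 1) has q^u-th power equal to
  -- the top term d^(-p) x^(q^n + q^u), where n = u + r.
  obtain ⟨α, hα⟩ := (iterateFrobeniusEquiv K p (k * u)).surjective (d ^ p)⁻¹
  rw [iterateFrobeniusEquiv_apply, iterateFrobenius_def] at hα
  have hα0 : α ≠ 0 := by
    rintro rfl
    rw [zero_pow (pow_ne_zero _ hp.ne_zero)] at hα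
    exact inv_ne_zero (pow_ne_zero p hd) hα.symm
  set D := algebraMap K F d with hD
  have hD0 : D ≠ 0 := by simpa [hD] using hd
  set Q := (p ^ k) ^ r with hQ
  set e : F := algebraMap K F α * x ^ (Q + 1) with he
  -- The sum telescopes: a^p - a = e^(q^u) - e, so subtracting a from z/d replaces the top term by
  -- e.
  set a : F := ∑ j ∈ Finset.range (k * u), e ^ p ^ j with ha
  have hae : a ^ p - a = e ^ p ^ (k * u) - e := by
    rw [ha, sum_pow_char]
    simp_rw [← pow_mul, ← pow_succ]
    rw [← Finset.sum_sub_distrib, Finset.sum_range_sub (fun j => e ^ p ^ j)]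
    simp
  have hepow : e ^ p ^ (k * u) = (D ^ p)⁻¹ * x ^ ((p ^ k) ^ (u + r) + (p ^ k) ^ u) := by
    rw [he, mul_pow, ← map_pow, hα, map_inv₀, map_pow, ← pow_mul]
    congr 2
    rw [pow_add (p ^ k) u r, pow_mul p k u, hQ]; ring
  have hDp : D ^ p = D ^ (p - 1) * D := by rw [← pow_succ, Nat.sub_add_cancel hp.one_le]
  have hZ : (z / D - a) ^ p - (z / D - a) = e - (D ^ p)⁻¹ * x ^ ((p ^ k) ^ u + 1) := by
    have h1 : (z / D) ^ p - z / D = (D ^ p)⁻¹ *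
        (x ^ ((p ^ k) ^ (u + r) + (p ^ k) ^ u) - x ^ ((p ^ k) ^ u + 1)) := by
      rw [← hz, div_pow]
      field_simp
      rw [hDp]; ring
    rw [sub_pow_char, sub_sub_sub_comm, h1, hae, hepow]; ring
  -- Here u < r is essential: e, of degree q^r + 1, dominates the remaining term of degree q^u + 1.
  have hlt : (p ^ k) ^ u < Q := Nat.pow_lt_pow_right (Nat.one_lt_pow hk hp.one_lt) hur
  have hvR : v (e - (D ^ p)⁻¹ * x ^ ((p ^ k) ^ u + 1)) = v x ^ (Q + 1) := by
    have hve : v e = v x ^ (Q + 1) := by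
      rw [he, map_mul, valuation_algebraMap_eq_one v hα0, one_mul, map_pow]
    rw [v.map_sub_eq_of_lt_left, hve]
    rw [hve, map_mul, map_inv₀, map_pow, valuation_algebraMap_eq_one v hd, one_pow, inv_one,
      one_mul, map_pow]
    exact pow_lt_pow_right₀ hx (by omega)
  have hX1 : 1 < v x ^ (Q + 1) := one_lt_pow₀ hx (by omega)
  set Z := z / D - a
  have hZ1 : 1 < v Z := by
    by_contra! h
    refine hX1.not_ge ?_
    rw [← hvR, ← hZ]
    exact v.map_sub_le ((map_pow v Z p).trans_le (pow_le_one' h _)) h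
  have hfin : v Z ^ p = v x ^ (Q + 1) := by
    rw [← hvR, ← hZ]
    have := valuation_pow_sub_pow_of_one_lt v hZ1 hp.one_lt
    rw [pow_one] at this
    exact this.symm
  have hlog := congrArg log hfin
  rw [log_pow, log_pow, nsmul_eq_mul, nsmul_eq_mul] at hlog
  have hcop : IsCoprime (p : ℤ) ((Q + 1 : ℕ) : ℤ) := by
    rw [Nat.isCoprime_iff_coprime]
    obtain ⟨m, hm⟩ : p ∣ Q := dvd_pow (dvd_pow_self p hk) (by omega)
    rw [hm]
    simp
  exact hcop.dvd_of_dvd_mul_left ⟨_, hlog.symm⟩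

/-! ### Total ramification above the pole of x, and irreducibility -/

section TotalRamification

/-- Supplies the finite residue field required by `exists_valuation_fixedField_of_inertia_le`. -/
theorem finite_quotient_idealX (K : Type*) [Field K] [Finite K] :
    Finite (K[X] ⧸ (idealX K).asIdeal) := by
  have : Module.Finite K (AdjoinRoot (X : K[X])) := monic_X.finite_adjoinRoot
  exact Module.finite_of_finite K (M := AdjoinRoot (X : K[X]))

theorem valuation_idealX_inv (K k : Type*) [Field K] [Field k] [Algebra K[X] k]
    [IsFractionRing K[X] k] : (idealX K).valuation k (algebraMap K[X] k X)⁻¹ = exp 1 := by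
  rw [map_inv₀, HeightOneSpectrum.valuation_of_algebraMap,
    HeightOneSpectrum.intValuation_singleton _ X_ne_zero rfl, exp_neg, inv_inv]

variable {K : Type*} [Field K] (V : AddSubgroup K) [Fintype V]

/-- Translation invariance makes every y + v a root of g(Y) - f. These are |V| distinct roots of a
monic polynomial of degree |V|. -/
theorem map_vanishingPolynomial_sub_C {F : Type*} [Field F] [Algebra K F] {y f : F}
    (hy : aeval y (vanishingPolynomial V) = f) :
    (vanishingPolynomial V).map (algebraMap K F) - C f =
      ∏ v : V, (X - C (y + algebraMap K F v)) := by
  classical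
  have hm := vanishingPolynomial.monic V
  have hd := vanishingPolynomial.natDegree_eq V
  set g := vanishingPolynomial V with hg
  have hpm : (∏ v : V, (X - C (y + algebraMap K F v))).Monic :=
    monic_prod_of_monic _ _ fun _ _ => monic_X_sub_C _
  have hpd : (∏ v : V, (X - C (y + algebraMap K F v))).degree =
      (Fintype.card V : WithBot ℕ) := by
    rw [degree_eq_natDegree hpm.ne_zero, natDegree_prod_of_monic _ _ fun _ _ => monic_X_sub_C _]
    simp only [natDegree_X_sub_C]
    simp
  have hgm : (g.map (algebraMap K F)).degree = Fintype.card V := by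
    rw [degree_map, degree_eq_natDegree hm.ne_zero, hd]
  have hlow : (C f : F[X]).degree < (g.map (algebraMap K F)).degree := by
    refine lt_of_le_of_lt degree_C_le ?_
    rw [hgm]
    exact_mod_cast Fintype.card_pos
  have hinj : Function.Injective fun v : V => y + algebraMap K F v := fun a b hab =>
    Subtype.ext ((algebraMap K F).injective (add_left_cancel hab))
  refine sub_eq_zero.1 (eq_zero_of_degree_lt_of_eval_finset_eq_zero
    (Finset.univ.image fun v : V => y + algebraMap K F v) ?_ ?_)
  · rw [Finset.card_image_of_injective _ hinj, Finset.card_univ, ← hpd]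
    have h1 : (g.map (algebraMap K F) - C f).Monic := (hm.map _).sub_of_left hlow
    refine degree_sub_lt_right ?_ hpm.ne_zero (by rw [h1.leadingCoeff, hpm.leadingCoeff])
    rw [degree_sub_eq_left_of_degree_lt hlow, hgm, hpd]
  · intro z hz
    obtain ⟨v, -, rfl⟩ := Finset.mem_image.1 hz
    have h1 : eval (y + algebraMap K F v) (∏ v : V, (X - C (y + algebraMap K F v))) = 0 := by
      rw [eval_prod]
      exact Finset.prod_eq_zero (Finset.mem_univ v) (by simp)
    have h2 := congrArg (aeval y) (vanishingPolynomial.comp_X_add_C V v.2)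
    rw [aeval_comp, map_add, aeval_X, aeval_C, ← hg, hy] at h2
    rw [eval_sub, h1, eval_sub, eval_map_algebraMap, h2, eval_C]
    simp

variable {k F : Type*} [Field k] [Field F] [Algebra K k] [Algebra K F] [Algebra k F]
  [IsScalarTower K k F]

theorem isSplittingField_of_aeval_vanishingPolynomial {y : F} {f : k}
    (hy : aeval y (vanishingPolynomial V) = algebraMap k F f)
    (hgen : IntermediateField.adjoin k {y} = ⊤) :
    ((vanishingPolynomial V).map (algebraMap K k) - C f).IsSplittingField k F ∧
      ((vanishingPolynomial V).map (algebraMap K k) - C f).Separable := by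
  have hmap : ((vanishingPolynomial V).map (algebraMap K k) - C f).map (algebraMap k F) =
      ∏ v : V, (X - C (y + algebraMap K F v)) := by
    rw [Polynomial.map_sub, Polynomial.map_map, ← IsScalarTower.algebraMap_eq, map_C,
      map_vanishingPolynomial_sub_C V hy]
  constructor
  · rw [isSplittingField_iff_intermediateField]
    refine ⟨?_, ?_⟩
    · rw [hmap]
      exact Splits.prod fun _ _ => Splits.X_sub_C _
    · rw [eq_top_iff, ← hgen]
      refine IntermediateField.adjoin.mono _ _ _ (Set.singleton_subset_iff.2 ?_)
      rw [mem_rootSet']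
      refine ⟨?_, ?_⟩
      · rw [hmap]
        exact (monic_prod_of_monic _ _ fun _ _ => monic_X_sub_C _).ne_zero
      · rw [← eval_map_algebraMap, hmap, eval_prod]
        exact Finset.prod_eq_zero (Finset.mem_univ 0) (by simp)
  · rw [← separable_map (algebraMap k F), hmap, separable_prod_X_sub_C_iff]
    exact fun a b hab => Subtype.ext ((algebraMap K F).injective (add_left_cancel hab))

theorem exists_algEquiv_apply_eq_add {y : F} {f : k}
    (hy : aeval y (vanishingPolynomial V) = algebraMap k F f) (σ : Gal(F/k)) :
    ∃ v ∈ V, σ y = y + algebraMap K F v := by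
  have h1 : aeval (σ y) (vanishingPolynomial V) = algebraMap k F f := by
    have := congrArg σ hy
    rw [AlgEquiv.commutes] at this
    rw [← this]
    exact aeval_algHom_apply (σ.toAlgHom.restrictScalars K) y _
  have h2 := congrArg (eval (σ y)) (map_vanishingPolynomial_sub_C V hy)
  rw [eval_sub, eval_map_algebraMap, h1, eval_C, sub_self, eval_prod, eq_comm,
    Finset.prod_eq_zero_iff] at h2
  obtain ⟨v, -, hv⟩ := h2
  rw [eval_sub, eval_X, eval_C, sub_eq_zero] at hv
  exact ⟨v, v.2, hv⟩

/-- The translations of `y` induced by a group of automorphisms. -/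
def translationSubgroup (K : Type*) [Field K] [Algebra K k] [Algebra K F] [IsScalarTower K k F]
    (y : F) (H : Subgroup Gal(F/k)) : AddSubgroup K where
  carrier := {c | ∃ σ ∈ H, σ y = y + algebraMap K F c}
  zero_mem' := ⟨1, H.one_mem, by simp⟩
  add_mem' := by
    rintro a b ⟨σ, hσ, h1⟩ ⟨τ, hτ, h2⟩
    refine ⟨σ * τ, H.mul_mem hσ hτ, ?_⟩
    have : σ (algebraMap K F b) = algebraMap K F b := by
      rw [IsScalarTower.algebraMap_apply K k F, AlgEquiv.commutes]
    rw [AlgEquiv.mul_apply, h2, map_add, h1, this, map_add, add_assoc]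
  neg_mem' := by
    rintro a ⟨σ, hσ, h1⟩
    refine ⟨σ⁻¹, H.inv_mem hσ, ?_⟩
    have : σ⁻¹ (algebraMap K F a) = algebraMap K F a := by
      rw [IsScalarTower.algebraMap_apply K k F, AlgEquiv.commutes]
    have h2 : σ⁻¹ (σ y) = y := by rw [← AlgEquiv.mul_apply]; simp
    rw [h1, map_add, this] at h2
    rw [map_neg, ← sub_eq_add_neg, eq_sub_iff_add_eq, h2]

variable [Finite K] [Algebra K[X] k] [IsFractionRing K[X] k]
  [Algebra K[X] F] [IsScalarTower K[X] k F]

/-- The Galois extension obtained by adjoining a root `y` of `g(Y) = x ^ (q ^ n + q ^ u) -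
x ^ (q ^ u + 1)` to the rational function field, `g` the vanishing polynomial of `V`, has
Galois group `V` and is totally ramified at the pole `X = 1 / x = 0` of `x`. -/
theorem inertia_eq_top_and_card_eq (p e u r : ℕ) [Fact p.Prime] [CharP K p] (he : e ≠ 0)
    (hur : u < r) [FiniteDimensional k F] [IsGalois k F] {y : F} {x : k}
    (hx : x = (algebraMap K[X] k X)⁻¹)
    (hy : aeval y (vanishingPolynomial V) = algebraMap k F
      (x ^ ((p ^ e) ^ (u + r) + (p ^ e) ^ u) - x ^ ((p ^ e) ^ u + 1)))
    (hgen : IntermediateField.adjoin k {y} = ⊤)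
    (P : Ideal (integralClosure K[X] F)) [P.IsPrime] [P.LiesOver (idealX K).asIdeal] :
    P.inertia Gal(F/k) = ⊤ ∧ Nat.card Gal(F/k) = Nat.card V := by
  have := finite_quotient_idealX K
  have hext : ∀ σ τ : Gal(F/k), σ y = τ y → σ = τ := fun σ τ h => by
    ext z
    have hz : z ∈ IntermediateField.adjoin k {y} := hgen ▸ IntermediateField.mem_top
    induction hz using IntermediateField.adjoin_induction with
    | mem z hz => rwa [Set.mem_singleton_iff.1 hz]
    | algebraMap a => simp
    | add a b _ _ ha hb => rw [map_add, map_add, ha, hb]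
    | inv a _ ha => rw [map_inv₀, map_inv₀, ha]
    | mul a b _ _ ha hb => rw [map_mul, map_mul, ha, hb]
  set I := P.inertia Gal(F/k) with hI
  set U := translationSubgroup K y I with hU
  have hUV : U ≤ V := by
    rintro c ⟨σ, -, hσ⟩
    obtain ⟨v, hv, h⟩ := exists_algEquiv_apply_eq_add V hy σ
    rw [hσ] at h
    rwa [(algebraMap K F).injective (add_left_cancel h)]
  -- For U proper, z = h(y) is fixed by inertia, so on the fixed field of its stabilizer the
  -- valuation of x is still `exp 1`; the Artin-Schreier equation for z then gives p ∣ 1.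
  have hUV' : U = V := by
    by_contra hne
    obtain ⟨h, d, hd, hinv, hdec⟩ := exists_artinSchreier_decomposition p
      (lt_of_le_of_ne hUV hne) (vanishingPolynomial.monic V)
      (by rw [vanishingPolynomial.natDegree_eq, Nat.card_eq_fintype_card])
      fun v hv => (vanishingPolynomial.eval_eq_zero_iff V v).2 hv
    set z := aeval y h with hz
    let H : Subgroup Gal(F/k) := MulAction.stabilizer _ z
    have hIH : I ≤ H := by
      intro σ hσ
      obtain ⟨v, hv, hσv⟩ := exists_algEquiv_apply_eq_add V hy σ
      have hvU : v ∈ U := ⟨σ, hσ, hσv⟩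
      change σ z = z
      have h1 : σ z = aeval (σ y) h :=
        (aeval_algHom_apply (σ.toAlgHom.restrictScalars K) y h).symm
      have h2 := congrArg (aeval y) (hinv v hvU)
      rwa [aeval_comp, map_add, aeval_X, aeval_C, ← hσv, ← h1] at h2
    obtain ⟨w, hw⟩ := exists_valuation_fixedField_of_inertia_le (K := k) (idealX K) P H hIH
    let zE : IntermediateField.fixedField H := ⟨z, fun σ => σ.2⟩
    have hwx : w (algebraMap k _ x) = exp 1 := by
      rw [hw, hx, valuation_idealX_inv]
    have hdvd := dvd_log_valuation_of_artinSchreier (K := K) p e u r he hur w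
      (x := algebraMap k _ x) (z := zE) hd (by rw [hwx, ← exp_zero, exp_lt_exp]; norm_num) (by
        refine (algebraMap (IntermediateField.fixedField H) F).injective ?_
        have h1 := congrArg (aeval y) hdec
        rw [hy] at h1
        simp only [map_sub, map_pow, map_mul, aeval_C, ← hz] at h1
        simp only [map_sub, map_pow, map_mul, ← IsScalarTower.algebraMap_apply]
        exact h1.symm)
    rw [hwx, log_exp] at hdvd
    have := Int.eq_one_of_dvd_one (by positivity) hdvd
    exact (Fact.out : p.Prime).one_lt.ne' (by exact_mod_cast this)
  have hI' : I = ⊤ := by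
    rw [eq_top_iff]
    intro σ _
    obtain ⟨v, hv, hσv⟩ := exists_algEquiv_apply_eq_add V hy σ
    rw [← hUV'] at hv
    obtain ⟨τ, hτ, hτv⟩ := hv
    rwa [hext σ τ (hσv.trans hτv.symm)]
  refine ⟨hI', ?_⟩
  choose φ hφV hφ using exists_algEquiv_apply_eq_add V hy
  refine Nat.card_eq_of_bijective (fun σ => (⟨φ σ, hφV σ⟩ : V)) ⟨fun σ τ h => ?_, fun v => ?_⟩
  · have h : φ σ = φ τ := congrArg Subtype.val h
    exact hext σ τ (by rw [hφ, hφ, h])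
  · obtain ⟨τ, -, hτ⟩ := hUV'.ge v.2
    refine ⟨τ, Subtype.ext ((algebraMap K F).injective ?_)⟩
    have := hφ τ
    rw [hτ] at this
    exact (add_left_cancel this).symm

end TotalRamification

/-- The curve polynomial attached to a vanishing polynomial is irreducible. -/
theorem irreducible_curvePolynomial {K : Type*} [Field K] [Finite K] (V : AddSubgroup K)
    [Fintype V] (p e u r : ℕ) [Fact p.Prime] [CharP K p] (he : e ≠ 0) (hur : u < r) :
    Irreducible (curvePolynomial (p ^ e) (u + r) r (vanishingPolynomial V)) := by
  let k := RatFunc K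
  -- The variable of `K[X]` is 1/x, so that the pole of x becomes the prime (X).
  let x : k := (algebraMap K[X] k X)⁻¹
  let f : k := x ^ ((p ^ e) ^ (u + r) + (p ^ e) ^ u) - x ^ ((p ^ e) ^ u + 1)
  let G : k[X] := (vanishingPolynomial V).map (algebraMap K k) - C f
  have hm := vanishingPolynomial.monic V
  have hVpos : 0 < Fintype.card V := Fintype.card_pos
  have hlow : (C f : k[X]).degree < ((vanishingPolynomial V).map (algebraMap K k)).degree := by
    refine lt_of_le_of_lt degree_C_le ?_
    rw [degree_map, degree_eq_natDegree hm.ne_zero, vanishingPolynomial.natDegree_eq]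
    exact_mod_cast hVpos
  have hGm : G.Monic := (hm.map _).sub_of_left hlow
  have hGd : G.natDegree = Fintype.card V := by
    rw [← vanishingPolynomial.natDegree_eq V, ← natDegree_map (algebraMap K k)]
    exact natDegree_eq_of_degree_eq (degree_sub_eq_left_of_degree_lt hlow)
  -- Any irreducible factor m will do: total ramification in k[Y]/(m) gives deg m = |V| = deg G, so
  -- the cofactor is a unit.
  obtain ⟨m, hmirr, hmG⟩ := exists_irreducible_of_natDegree_pos (hGd ▸ hVpos)
  have : Fact (Irreducible m) := ⟨hmirr⟩
  let F := AdjoinRoot m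
  let y : F := AdjoinRoot.root m
  have hGy : aeval y G = 0 := by
    obtain ⟨c, hc⟩ := hmG
    rw [hc, map_mul, AdjoinRoot.aeval_eq, AdjoinRoot.mk_self, zero_mul]
  have hy : aeval y (vanishingPolynomial V) = algebraMap k F f := by
    rw [map_sub, aeval_C, aeval_map_algebraMap, sub_eq_zero] at hGy
    exact hGy
  have hgen : IntermediateField.adjoin k {y} = ⊤ := IntermediateField.adjoin_root_eq_top m
  obtain ⟨hsplit, hsep⟩ := isSplittingField_of_aeval_vanishingPolynomial V hy hgen
  have : FiniteDimensional k F := IsSplittingField.finiteDimensional F G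
  have : IsGalois k F := IsGalois.of_separable_splitting_field hsep
  have hinj : Function.Injective (algebraMap K[X] F) := by
    rw [IsScalarTower.algebraMap_eq K[X] k F]
    exact (algebraMap k F).injective.comp (IsFractionRing.injective K[X] k)
  have hinj' : Function.Injective (algebraMap K[X] (integralClosure K[X] F)) :=
    fun a b hab => hinj (congrArg Subtype.val hab)
  have : FaithfulSMul K[X] (integralClosure K[X] F) :=
    (faithfulSMul_iff_algebraMap_injective _ _).2 hinj'
  have : (idealX K).asIdeal.IsPrime := (idealX K).isPrime
  obtain ⟨P, _, _⟩ : Nonempty ((idealX K).asIdeal.primesOver (integralClosure K[X] F)) :=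
    inferInstance
  obtain ⟨-, hcard⟩ := inertia_eq_top_and_card_eq V p e u r he hur (x := x) rfl hy hgen P
  rw [IsGalois.card_aut_eq_finrank, Nat.card_eq_fintype_card,
    (AdjoinRoot.powerBasis hmirr.ne_zero).finrank, AdjoinRoot.powerBasis_dim] at hcard
  have hGirr : Irreducible G := by
    obtain ⟨c, hc⟩ := hmG
    have hc0 : c ≠ 0 := by
      rintro rfl
      exact hGm.ne_zero (by rw [hc, mul_zero])
    have hdeg := congrArg natDegree hc
    rw [natDegree_mul hmirr.ne_zero hc0, hGd, hcard] at hdeg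
    have hcu : IsUnit c := by
      rw [isUnit_iff_degree_eq_zero, degree_eq_natDegree hc0]
      exact_mod_cast (by omega : c.natDegree = 0)
    rw [hc]
    exact (irreducible_mul_isUnit hcu).2 hmirr
  -- The variable of the base ring of the curve polynomial is the function x, so it is sent to 1/X
  -- in `RatFunc K`.
  have hφ : (curvePolynomial (p ^ e) (u + r) r (vanishingPolynomial V)).map
      (aeval x : K[X] →ₐ[K] k).toRingHom = G := by
    have : ((aeval x : K[X] →ₐ[K] k).toRingHom).comp (C : K →+* K[X]) = algebraMap K k := by
      ext c; simp
    simp only [curvePolynomial, Polynomial.map_sub, Polynomial.map_map, this, map_C, G, f,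
      add_tsub_cancel_right]
    simp
  refine Monic.irreducible_of_irreducible_map (aeval x : K[X] →ₐ[K] k).toRingHom _ ?_ (hφ ▸ hGirr)
  refine (hm.map _).sub_of_left (lt_of_le_of_lt degree_C_le ?_)
  rw [hm.degree_map, degree_eq_natDegree hm.ne_zero, vanishingPolynomial.natDegree_eq]
  exact_mod_cast hVpos

/-! ### Normalized valuations and places -/

section Valuations

/-- Two normalized discrete valuations with the same valuation ring are equal. -/
theorem valuation_eq_of_isEquiv {F : Type*} [Field F] {v w : Valuation F ℤᵐ⁰}
    (hv : Function.Surjective v) (hw : Function.Surjective w) (h : v.IsEquiv w) : v = w := by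
  obtain ⟨a, ha⟩ := hv (exp (-1))
  obtain ⟨b, hb⟩ := hw (exp (-1))
  -- `exp (-1)` is the largest value below 1, so equivalence carries a uniformizer a of v to a
  -- uniformizer of w; powers of a then determine both valuations.
  have hlt : ∀ {c : ℤᵐ⁰}, c < 1 → c ≤ exp (-1) := fun {c} hc => by
    rcases eq_or_ne c 0 with rfl | hc0
    · exact zero_le
    · rw [← log_le_iff_le_exp hc0]
      rw [← exp_zero, ← log_lt_iff_lt_exp hc0] at hc
      omega
  have h1 : (exp (-1) : ℤᵐ⁰) < 1 := by rw [← exp_zero, exp_lt_exp]; norm_num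
  have hwa : w a = exp (-1) := by
    refine le_antisymm (hlt (h.lt_one_iff_lt_one.1 (ha ▸ h1))) ?_
    rw [← hb]
    refine (h b a).1 ?_
    rw [ha]
    exact hlt (h.lt_one_iff_lt_one.2 (hb ▸ h1))
  ext z
  rcases eq_or_ne z 0 with rfl | hz
  · simp
  have hz0 : v z ≠ 0 := (Valuation.ne_zero_iff _).2 hz
  have hvz : v z = v (a ^ (-log (v z))) := by
    rw [map_zpow₀, ha, ← exp_zsmul, smul_eq_mul, neg_mul_neg, mul_one, exp_log hz0]
  have hwz : w z = w (a ^ (-log (v z))) := h.eq_iff.1 hvz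
  calc v z = v (a ^ (-log (v z))) := hvz
    _ = w (a ^ (-log (v z))) := by rw [map_zpow₀, map_zpow₀, ha, hwa]
    _ = w z := hwz.symm

end Valuations

namespace Place

variable {K F : Type*} [Field K] [Field F] [Algebra K F]

theorem val_le_one_iff (P : Place K F) {z : F} : P.val z ≤ 1 ↔ z ∈ P.ring := by
  have := P.isDVR
  constructor
  · intro h
    obtain ⟨b, rfl⟩ := IsDiscreteValuationRing.exists_lift_of_le_one h
    exact b.2
  · intro hz
    exact (IsDiscreteValuationRing.maximalIdeal P.ring).valuation_le_one (⟨z, hz⟩ : P.ring)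

theorem val_surjective (P : Place K F) : Function.Surjective P.val := by
  have := P.isDVR
  exact (IsDiscreteValuationRing.maximalIdeal P.ring).valuation_surjective F

theorem val_algebraMap_le_one (P : Place K F) (c : K) : P.val (algebraMap K F c) ≤ 1 :=
  P.val_le_one_iff.2 (P.algebraMap_mem c)

theorem ext_ring {P Q : Place K F} (h : P.ring = Q.ring) : P = Q := by
  cases P; cases Q; cases h; rfl

theorem val_eq_of_forall_mem_ring_iff (P : Place K F) {w : Valuation F ℤᵐ⁰}
    (hw : Function.Surjective w) (h : ∀ z, z ∈ P.ring ↔ w z ≤ 1) : P.val = w :=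
  valuation_eq_of_isEquiv P.val_surjective hw
    (Valuation.isEquiv_iff_val_le_one.2 fun {z} => P.val_le_one_iff.trans (h z))

/-- The place given by a maximal ideal of a Dedekind domain containing the constants. -/
def ofHeightOneSpectrum {B : Type*} [CommRing B] [IsDedekindDomain B] [Algebra B F]
    [IsFractionRing B F] [Algebra K B] [IsScalarTower K B F] (c : HeightOneSpectrum B) :
    Place K F where
  ring := (c.valuation F).valuationSubring
  algebraMap_mem a := by
    rw [IsScalarTower.algebraMap_apply K B F]
    exact c.valuation_le_one _
  isDVR := inferInstance

end Place

namespace Place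

theorem val_ofHeightOneSpectrum {K F : Type*} [Field K] [Field F] [Algebra K F] {B : Type*}
    [CommRing B] [IsDedekindDomain B] [Algebra B F] [IsFractionRing B F] [Algebra K B]
    [IsScalarTower K B F] (c : HeightOneSpectrum B) :
    (ofHeightOneSpectrum c : Place K F).val = c.valuation F :=
  val_eq_of_forall_mem_ring_iff _ (c.valuation_surjective F) fun _ => Iff.rfl

/-- A place whose ring contains `B` and whose centre on `B` is `c` is the place given by `c`. -/
theorem eq_ofHeightOneSpectrum {K F : Type*} [Field K] [Field F] [Algebra K F] {B : Type*}
    [CommRing B] [IsDedekindDomain B] [Algebra B F] [IsFractionRing B F] [Algebra K B]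
    [IsScalarTower K B F] (c : HeightOneSpectrum B) (Q : Place K F)
    (hB : ∀ b : B, Q.val (algebraMap B F b) ≤ 1)
    (hc : ∀ b : B, Q.val (algebraMap B F b) < 1 ↔ b ∈ c.asIdeal) :
    Q = ofHeightOneSpectrum c := by
  have hd : ∀ d : c.asIdeal.primeCompl, Q.val (algebraMap B F d) = 1 := fun d =>
    le_antisymm (hB _) (not_lt.1 fun h => d.2 ((hc _).1 h))
  have hle : ∀ z, c.valuation F z ≤ 1 → Q.val z ≤ 1 := fun z hz => by
    obtain ⟨n, d, hnd⟩ := c.exists_primeCompl_mul_eq_of_integer z hz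
    have := congrArg Q.val hnd
    rw [map_mul, hd, mul_one] at this
    exact this ▸ hB n
  have hlt : ∀ z, c.valuation F z < 1 → Q.val z < 1 := fun z hz => by
    obtain ⟨n, d, hnd⟩ := c.exists_primeCompl_mul_eq_of_integer z hz.le
    have h1 := congrArg Q.val hnd
    have h2 := congrArg (c.valuation F) hnd
    have h3 : c.valuation F (algebraMap B F d) = 1 := by
      rw [HeightOneSpectrum.valuation_eq_one_iff_notMem]
      exact d.2
    rw [map_mul, hd, mul_one] at h1
    rw [map_mul, h3, mul_one] at h2
    rw [h1, hc, ← c.valuation_lt_one_iff_mem (K := F), ← h2]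
    exact hz
  refine ext_ring (SetLike.ext fun z => ?_)
  change z ∈ Q.ring ↔ c.valuation F z ≤ 1
  rw [← Q.val_le_one_iff]
  refine ⟨fun h => ?_, hle z⟩
  -- If z had a pole at c, then z⁻¹ would have value below 1 at c, hence at Q, contradicting that z
  -- is regular at Q.
  by_contra! hz
  have hz1 : Q.val z⁻¹ < 1 := hlt _ (by rw [map_inv₀]; exact inv_lt_one_of_one_lt₀ hz)
  rw [map_inv₀] at hz1
  rcases eq_or_ne z 0 with rfl | hz0
  · simp at hz
  · have : 0 < Q.val z := zero_lt_iff.2 ((Valuation.ne_zero_iff _).2 hz0)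
    exact ((inv_lt_one₀ this).1 hz1).not_ge h

end Place

/-- A prime of inertia degree one has the same residue field as the prime below. -/
theorem exists_algebraMap_sub_mem_of_inertiaDeg_eq_one {A B : Type*} [CommRing A] [CommRing B]
    [Algebra A B] (p : Ideal A) (P : Ideal B) [P.LiesOver p] [p.IsMaximal] [P.IsMaximal]
    (h : P.inertiaDeg A = 1) (b : B) : ∃ a : A, algebraMap A B a - b ∈ P := by
  rw [Ideal.inertiaDeg_eq_of_isMaximal p P] at h
  let : Field (A ⧸ p) := Ideal.Quotient.field _
  let : Field (B ⧸ P) := Ideal.Quotient.field _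
  obtain ⟨a, ha⟩ := (finrank_eq_one_iff_of_nonzero' (1 : B ⧸ P) one_ne_zero).1 h
    (Ideal.Quotient.mk P b)
  obtain ⟨g, rfl⟩ := Ideal.Quotient.mk_surjective a
  rw [Algebra.smul_def, mul_one] at ha
  refine ⟨g, ?_⟩
  rw [← Ideal.Quotient.eq, ← ha]
  rfl

/-! ### The unique place at infinity and the pole divisors -/

section Infinity

variable {K k F : Type*} [Field K] [Field k] [Field F] [Algebra K k] [Algebra K F]
  [Algebra k F] [IsScalarTower K k F] [Algebra K[X] k] [IsFractionRing K[X] k] [Algebra K[X] F]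
  [IsScalarTower K[X] k F] [IsScalarTower K K[X] F]

/-- The integral closure of `K[X]` is contained in the ring of every place at which `X` is
regular. -/
theorem val_integralClosure_le_one (Q : Place K F) (hX : Q.val (algebraMap K[X] F X) ≤ 1)
    (b : integralClosure K[X] F) : Q.val b ≤ 1 := by
  have hmem : ∀ g : K[X], algebraMap K[X] F g ∈ Q.ring := fun g => by
    rw [← Q.val_le_one_iff]
    have : algebraMap K[X] F g = aeval (algebraMap K[X] F X) g := by
      rw [aeval_algebraMap_apply, aeval_X_left_apply]
    rw [this]
    exact valuation_aeval_le_one _ Q.val_algebraMap_le_one g hX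
  let : Algebra K[X] Q.ring := ((algebraMap K[X] F).codRestrict Q.ring hmem).toAlgebra
  have : IsScalarTower K[X] Q.ring F := IsScalarTower.of_algebraMap_eq fun _ => rfl
  -- The valuation ring contains `K[X]` and is integrally closed.
  have hb : IsIntegral Q.ring (b : F) := IsIntegral.tower_top (R := K[X]) b.2
  obtain ⟨z, hz⟩ := IsIntegrallyClosed.isIntegral_iff.1 hb
  rw [Q.val_le_one_iff, ← hz]
  exact z.2

/-- The function field of the curve has a single place at which `x` has a pole; it is rational
and the pole has order the degree of the extension. -/
theorem exists_place_of_isFractionRing [Finite K] (V : AddSubgroup K) [Fintype V] (p e u r : ℕ)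
    [Fact p.Prime] [CharP K p] (he : e ≠ 0) (hur : u < r) {y : F} {x : k}
    (hx : x = (algebraMap K[X] k X)⁻¹)
    (hy : aeval y (vanishingPolynomial V) = algebraMap k F
      (x ^ ((p ^ e) ^ (u + r) + (p ^ e) ^ u) - x ^ ((p ^ e) ^ u + 1)))
    (hgen : IntermediateField.adjoin k {y} = ⊤) :
    ∃ P : Place K F, P.IsRational ∧ (∀ Q : Place K F, 1 < Q.val (algebraMap k F x) ↔ Q = P) ∧
      P.val (algebraMap k F x) = exp (Nat.card V : ℤ) := by
  obtain ⟨hsplit, hsep⟩ := isSplittingField_of_aeval_vanishingPolynomial V hy hgen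
  have : FiniteDimensional k F := IsSplittingField.finiteDimensional F
    ((vanishingPolynomial V).map (algebraMap K k) -
      C (x ^ ((p ^ e) ^ (u + r) + (p ^ e) ^ u) - x ^ ((p ^ e) ^ u + 1)))
  have : IsGalois k F := IsGalois.of_separable_splitting_field hsep
  let B := integralClosure K[X] F
  have hinj : Function.Injective (algebraMap K[X] F) := by
    rw [IsScalarTower.algebraMap_eq K[X] k F]
    exact (algebraMap k F).injective.comp (IsFractionRing.injective K[X] k)
  have hinj' : Function.Injective (algebraMap K[X] B) := fun a b hab =>
    hinj (congrArg Subtype.val hab)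
  have : FaithfulSMul K[X] B := (faithfulSMul_iff_algebraMap_injective _ _).2 hinj'
  have : Module.IsTorsionFree K[X] B := Module.isTorsionFree_iff_algebraMap_injective.2 hinj'
  have : IsDedekindDomain B := IsIntegralClosure.isDedekindDomain K[X] k F B
  have : IsFractionRing B F := IsIntegralClosure.isFractionRing_of_finite_extension K[X] k F B
  have : Module.Finite K[X] B := IsIntegralClosure.finite K[X] k F B
  have : IsGaloisGroup Gal(F/k) K[X] B := .of_isFractionRing _ _ _ k F
  have : (idealX K).asIdeal.IsMaximal := (idealX K).isMaximal
  have := finite_quotient_idealX K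
  obtain ⟨P, _, _⟩ : Nonempty ((idealX K).asIdeal.primesOver B) := inferInstance
  obtain ⟨hI, hcard⟩ := inertia_eq_top_and_card_eq V p e u r he hur hx hy hgen P
  have hram := Ideal.card_inertia_eq_ramificationIdxIn (G := Gal(F/k)) (idealX K).asIdeal P
  rw [hI, Subgroup.card_top] at hram
  have hfund := Ideal.ncard_primesOver_mul_ramificationIdxIn_mul_inertiaDegIn
    (idealX K).asIdeal B Gal(F/k)
  -- In the identity (number of primes) · e · f = |Gal|, inertia being the whole group gives e =
  -- |Gal|.
  have hone : ((idealX K).asIdeal.primesOver B).ncard * (idealX K).asIdeal.inertiaDegIn B = 1 := by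
    rw [← hram, mul_left_comm] at hfund
    exact (mul_eq_left₀ Nat.card_pos.ne').1 hfund
  obtain ⟨hncard, hdeg⟩ := mul_eq_one.1 hone
  rw [Ideal.ramificationIdxIn_eq_ramificationIdx _ P Gal(F/k), hcard] at hram
  rw [Ideal.inertiaDegIn_eq_inertiaDeg _ P Gal(F/k)] at hdeg
  let c : HeightOneSpectrum B :=
    ⟨P, inferInstance, Ideal.ne_bot_of_liesOver_of_ne_bot (idealX K).ne_bot P⟩
  have : P.IsMaximal := c.isMaximal
  have : c.asIdeal.LiesOver (idealX K).asIdeal := inferInstanceAs (P.LiesOver _)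
  have hcx : c.valuation F (algebraMap k F x) = exp (Nat.card V : ℤ) := by
    rw [← HeightOneSpectrum.valuation_liesOver F (idealX K) c, hx, valuation_idealX_inv,
      Ideal.ramificationIdx'_eq_ramificationIdx _ _ (idealX K).ne_bot, ← hram, ← exp_nsmul]
    simp
  have hXx : algebraMap K[X] F X = (algebraMap k F x)⁻¹ := by
    rw [hx, map_inv₀, inv_inv, IsScalarTower.algebraMap_apply K[X] k F]
  refine ⟨Place.ofHeightOneSpectrum c, ?_, ?_, ?_⟩
  · intro f hf
    rw [← Place.val_le_one_iff, Place.val_ofHeightOneSpectrum] at hf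
    rw [Place.val_ofHeightOneSpectrum]
    -- Modulo the maximal ideal, f is successively replaced by b in B, by a polynomial g since the
    -- inertia degree is 1, and by g(0) since X lies in P.
    obtain ⟨b, hb⟩ := c.exists_valuation_sub_lt_of_integer hf 1
    obtain ⟨g, hbg⟩ := exists_algebraMap_sub_mem_of_inertiaDeg_eq_one (idealX K).asIdeal P hdeg b
    have hg0 : g - C (g.coeff 0) ∈ (idealX K).asIdeal := by
      rw [idealX_span, Ideal.mem_span_singleton, X_dvd_iff]
      simp
    have hgP : algebraMap K[X] B (g - C (g.coeff 0)) ∈ P := by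
      rwa [← Ideal.mem_comap, ← Ideal.under_def, ← Ideal.over_def P (idealX K).asIdeal]
    have hbc := P.sub_mem hbg hgP
    have hval := (c.valuation_lt_one_iff_mem (K := F) _).2 hbc
    refine ⟨g.coeff 0, ?_⟩
    have hC : algebraMap B F (algebraMap K[X] B (C (g.coeff 0))) = algebraMap K F (g.coeff 0) := by
      rw [← IsScalarTower.algebraMap_apply K[X] B F, IsScalarTower.algebraMap_apply K K[X] F]
      rfl
    have hsplit : f - algebraMap K F (g.coeff 0) = -((algebraMap B F b - f) +
        algebraMap B F (algebraMap K[X] B g - b - algebraMap K[X] B (g - C (g.coeff 0)))) := by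
      simp only [map_sub, hC]
      ring
    rw [hsplit, Valuation.map_neg]
    exact Valuation.map_add_lt _ hb hval
  · intro Q
    constructor
    · intro hQ
      have hX : Q.val (algebraMap K[X] F X) < 1 := by
        rw [hXx, map_inv₀]
        exact inv_lt_one_of_one_lt₀ hQ
      have hB := val_integralClosure_le_one Q hX.le
      let ψ : B →+* Q.val.integer := (algebraMap B F).codRestrict _ hB
      -- The centre of Q on B. It contains X, hence equals the only prime P above (X).
      let 𝔮 : Ideal B := (IsLocalRing.maximalIdeal Q.val.integer).comap ψ
      have hmem : ∀ b : B, b ∈ 𝔮 ↔ Q.val (algebraMap B F b) < 1 := fun b => by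
        rw [Ideal.mem_comap, IsLocalRing.mem_maximalIdeal, mem_nonunits_iff,
          Valuation.Integers.isUnit_iff_valuation_eq_one (Valuation.integer.integers Q.val)]
        exact ⟨fun h => lt_of_le_of_ne (hB b) h, fun h => h.ne⟩
      have h𝔮 : 𝔮 = P := by
        have h1 : 𝔮.LiesOver (idealX K).asIdeal := by
          constructor
          refine (idealX K).isMaximal.eq_of_le (Ideal.IsPrime.ne_top inferInstance) ?_
          rw [idealX_span, Ideal.span_singleton_le_iff_mem, Ideal.under_def, Ideal.mem_comap, hmem,
            ← IsScalarTower.algebraMap_apply]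
          exact hX
        obtain ⟨a, ha⟩ := Set.ncard_eq_one.1 hncard
        have h2 : 𝔮 ∈ (idealX K).asIdeal.primesOver B := ⟨inferInstance, h1⟩
        have h3 : P ∈ (idealX K).asIdeal.primesOver B := ⟨inferInstance, inferInstance⟩
        rw [ha] at h2 h3
        rw [Set.mem_singleton_iff.1 h2, Set.mem_singleton_iff.1 h3]
      exact Place.eq_ofHeightOneSpectrum c Q hB fun b => by
        rw [← hmem, h𝔮]
    · rintro rfl
      rw [Place.val_ofHeightOneSpectrum, hcx, ← exp_zero, exp_lt_exp]
      exact_mod_cast Nat.card_pos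
  · rw [Place.val_ofHeightOneSpectrum, hcx]

end Infinity

/-- Embeds `RatFunc K` in F by X ↦ 1/x, so that F becomes an extension of K(x) generated by y. -/
theorem exists_place_of_transcendental {K F : Type*} [Field K] [Finite K] [Field F]
    [Algebra K F] (V : AddSubgroup K) [Fintype V] (p e u r : ℕ) [Fact p.Prime] [CharP K p]
    (he : e ≠ 0) (hur : u < r) {x y : F} (hx : Transcendental K x)
    (hy : aeval y (vanishingPolynomial V) =
      x ^ ((p ^ e) ^ (u + r) + (p ^ e) ^ u) - x ^ ((p ^ e) ^ u + 1))
    (hgen : IntermediateField.adjoin K {x, y} = ⊤) :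
    ∃ P : Place K F, P.IsRational ∧ (∀ Q : Place K F, 1 < Q.val x ↔ Q = P) ∧
      P.val x = exp (Nat.card V : ℤ) := by
  let k := RatFunc K
  have hx' : Transcendental K x⁻¹ := fun h => hx (by simpa using h.inv)
  let : Algebra K[X] F := (aeval x⁻¹ : K[X] →ₐ[K] F).toRingHom.toAlgebra
  have hinj : Function.Injective (algebraMap K[X] F) := transcendental_iff_injective.1 hx'
  let : Algebra k F := (IsFractionRing.lift hinj : k →+* F).toAlgebra
  have : IsScalarTower K[X] k F := IsScalarTower.of_algebraMap_eq fun g =>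
    (IsFractionRing.lift_algebraMap hinj g).symm
  have : IsScalarTower K K[X] F := IsScalarTower.of_algebraMap_eq fun c =>
    (aeval_C (A := F) x⁻¹ c).symm
  have : IsScalarTower K k F := IsScalarTower.of_algebraMap_eq fun c => by
    rw [IsScalarTower.algebraMap_apply K K[X] k, ← IsScalarTower.algebraMap_apply K[X] k F,
      ← IsScalarTower.algebraMap_apply K K[X] F]
  obtain ⟨t, ht0⟩ : ∃ t : k, t = (algebraMap K[X] k X)⁻¹ := ⟨_, rfl⟩
  have hX : algebraMap K[X] F X = x⁻¹ := aeval_X (R := K) x⁻¹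
  have ht : algebraMap k F t = x := by
    rw [ht0, map_inv₀, ← IsScalarTower.algebraMap_apply K[X] k F, hX, inv_inv]
  have hgen' : IntermediateField.adjoin k {y} = ⊤ := by
    rw [← IntermediateField.restrictScalars_eq_top_iff (K := K), eq_top_iff, ← hgen,
      IntermediateField.adjoin_le_iff]
    rintro z (hz | hz)
    · rw [hz, ← ht]
      exact (IntermediateField.adjoin k {y}).algebraMap_mem t
    · rw [Set.mem_singleton_iff.1 hz]
      exact IntermediateField.mem_adjoin_simple_self k y
  rw [← ht] at hy ⊢
  rw [← map_pow, ← map_pow, ← map_sub] at hy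
  exact exists_place_of_isFractionRing V p e u r he hur ht0 hy hgen'

/-- At every place, g(y) = f(x) shows that y has a pole exactly when x does, with |V| ord(y) = N
ord(x) for N = q^n + q^u. As |V| < N, the pole of y is the deeper one, so such a place lies over (0
: 1 : 0). -/
theorem exists_place_isPoleDivisor {K F : Type*} [Field K] [Finite K] [Field F] [Algebra K F]
    (V : AddSubgroup K) [Fintype V] (p e u r : ℕ) [Fact p.Prime] [CharP K p] (he : e ≠ 0)
    (hur : u < r) (hV : Nat.card V < (p ^ e) ^ (u + r)) {x y : F} (hx : Transcendental K x)
    (hy : aeval y (vanishingPolynomial V) =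
      x ^ ((p ^ e) ^ (u + r) + (p ^ e) ^ u) - x ^ ((p ^ e) ^ u + 1))
    (hgen : IntermediateField.adjoin K {x, y} = ⊤) :
    ∃ P : Place K F, P.IsRational ∧ (∀ Q : Place K F, Q.LiesOverInfinity x y ↔ Q = P) ∧
      IsPoleDivisor x (Finsupp.single P (Nat.card V : ℤ)) ∧
      IsPoleDivisor y (Finsupp.single P (((p ^ e) ^ (u + r) + (p ^ e) ^ u : ℕ) : ℤ)) := by
  obtain ⟨P, hrat, huniq, hPx⟩ := exists_place_of_transcendental V p e u r he hur hx hy hgen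
  have hp := (Fact.out : p.Prime)
  have hq : 1 < p ^ e := Nat.one_lt_pow he hp.one_lt
  set N := (p ^ e) ^ (u + r) + (p ^ e) ^ u with hN
  have hlt : (p ^ e) ^ u + 1 < N := by
    have : 1 < (p ^ e) ^ (u + r) := Nat.one_lt_pow (by omega) hq
    omega
  have hVpos : 0 < Nat.card V := Nat.card_pos
  have hdeg : (vanishingPolynomial V).natDegree = Nat.card V := by
    rw [vanishingPolynomial.natDegree_eq, Nat.card_eq_fintype_card]
  have hfle : ∀ Q : Place K F, Q.val x ≤ 1 → Q.val y ≤ 1 := fun Q h => by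
    by_contra! h1
    have h2 := congrArg Q.val hy
    rw [valuation_aeval_of_one_lt _ Q.val_algebraMap_le_one (vanishingPolynomial.monic V) h1,
      hdeg] at h2
    have h3 : Q.val (x ^ N - x ^ ((p ^ e) ^ u + 1)) ≤ 1 :=
      Q.val.map_sub_le ((map_pow _ _ _).trans_le (pow_le_one' h _))
        ((map_pow _ _ _).trans_le (pow_le_one' h _))
    exact (one_lt_pow₀ h1 hVpos.ne').not_ge (h2.trans_le h3)
  have hfx : ∀ Q : Place K F, 1 < Q.val x →
      1 < Q.val y ∧ Q.val y ^ Nat.card V = Q.val x ^ N := fun Q h => by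
    have h2 := congrArg Q.val hy
    rw [valuation_pow_sub_pow_of_one_lt _ h hlt] at h2
    have h1 : 1 < Q.val y := by
      by_contra! h1
      exact (one_lt_pow₀ h (by omega)).not_ge
        (h2.symm.trans_le (valuation_aeval_le_one _ Q.val_algebraMap_le_one _ h1))
    rw [valuation_aeval_of_one_lt _ Q.val_algebraMap_le_one (vanishingPolynomial.monic V) h1,
      hdeg] at h2
    exact ⟨h1, h2⟩
  -- The value 0 is covered because `log 0 = 0`.
  have hlog : ∀ {c : ℤᵐ⁰}, c ≤ 1 → log c ≤ 0 := fun {c} hc => by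
    rcases eq_or_ne c 0 with rfl | hc0
    · simp
    · rw [log_le_iff_le_exp hc0, exp_zero]
      exact hc
  have hle : ∀ Q : Place K F, Q ≠ P → Q.val x ≤ 1 := fun Q hQ => by
    by_contra! h
    exact hQ ((huniq Q).1 h)
  refine ⟨P, hrat, fun Q => ?_, fun Q => ?_, fun Q => ?_⟩
  · rw [← huniq Q]
    constructor
    · rintro ⟨-, h⟩
      by_contra! h'
      exact h.not_ge (hfle Q h')
    · intro h
      obtain ⟨h1, h2⟩ := hfx Q h
      refine ⟨?_, h1⟩
      by_contra! h3
      have h4 : Q.val y ^ Nat.card V ≤ Q.val x ^ Nat.card V := pow_le_pow_left' h3 _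
      exact (h2.symm.trans_le h4).not_gt (pow_lt_pow_right₀ h (by omega))
  · rcases eq_or_ne Q P with rfl | hQ
    · rw [Finsupp.single_eq_same, Place.ord, hPx, log_exp, neg_neg, max_eq_right (by positivity)]
    · rw [Finsupp.single_eq_of_ne hQ, Place.ord, neg_neg, max_eq_left (hlog (hle Q hQ))]
  · rcases eq_or_ne Q P with rfl | hQ
    · have h2 := congrArg log (hfx Q ((huniq Q).2 rfl)).2
      rw [log_pow, log_pow, hPx, log_exp, nsmul_eq_mul, nsmul_eq_mul, mul_comm] at h2
      have h3 := mul_right_cancel₀ (by exact_mod_cast hVpos.ne') h2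
      rw [Finsupp.single_eq_same, Place.ord, neg_neg, h3, max_eq_right (by positivity)]
    · rw [Finsupp.single_eq_of_ne hQ, Place.ord, neg_neg,
        max_eq_left (hlog (hfle Q (hle Q hQ)))]

/-! ### Root groups of subcover polynomials -/

section SubcoverPolynomials

variable {K : Type*} [Field K]

theorem IsQPolynomial.eval_add {p e : ℕ} [Fact p.Prime] [CharP K p] {f : K[X]}
    (hf : IsQPolynomial (p ^ e) f) (a b : K) : f.eval (a + b) = f.eval a + f.eval b := by
  obtain ⟨l, c, rfl⟩ := hf
  simp only [eval_finsetSum, eval_mul, eval_C, eval_pow, eval_X, ← Finset.sum_add_distrib,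
    ← mul_add, ← pow_mul, add_pow_char_pow]

theorem derivative_X_pow_charP {p e : ℕ} [CharP K p] (he : e ≠ 0) (i : ℕ) :
    derivative (X ^ (p ^ e) ^ i : K[X]) = if i = 0 then 1 else 0 := by
  rcases eq_or_ne i 0 with rfl | hi
  · simp
  · rw [derivative_X_pow, if_neg hi]
    simp [he, hi]

theorem IsQPolynomial.exists_derivative_eq_C {p e : ℕ} [CharP K p] (he : e ≠ 0) {f : K[X]}
    (hf : IsQPolynomial (p ^ e) f) : ∃ c : K, derivative f = C c := by
  obtain ⟨l, a, rfl⟩ := hf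
  exact ⟨a 0, by simp [derivative_X_pow_charP he]⟩

theorem derivative_tracePolynomial {p e n : ℕ} [CharP K p] (he : e ≠ 0) (hn : 0 < n) :
    derivative (tracePolynomial K (p ^ e) n) = 1 := by
  simp [tracePolynomial, derivative_X_pow_charP he, hn.ne']

namespace IsSubcoverPolynomial

variable {p e n s : ℕ} {gs : K[X]}

/-- The derivative of a q-polynomial is a constant c. The chain rule for g_s(g) = T_n, whose
derivative is 1, forces c ≠ 0. -/
theorem separable [CharP K p] (he : e ≠ 0) (hn : 0 < n)
    (h : IsSubcoverPolynomial (p ^ e) n s gs) : gs.Separable := by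
  obtain ⟨c, hc⟩ := h.isQPolynomial.exists_derivative_eq_C he
  obtain ⟨g, -, -, hg⟩ := h.exists_comp_eq
  have h1 := congrArg derivative hg
  rw [derivative_tracePolynomial he hn, derivative_comp, hc, C_comp] at h1
  have hc0 : c ≠ 0 := by
    rintro rfl
    simp at h1
  rw [separable_def, hc]
  exact ⟨0, C c⁻¹, by rw [zero_mul, zero_add, ← C_mul, inv_mul_cancel₀ hc0, C_1]⟩

/-- The additive group of roots of a subcover polynomial. -/
def rootGroup [Fact p.Prime] [CharP K p] (h : IsSubcoverPolynomial (p ^ e) n s gs) :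
    AddSubgroup K :=
  (AddMonoidHom.mk' (fun a => gs.eval a) h.isQPolynomial.eval_add).ker

theorem mem_rootGroup [Fact p.Prime] [CharP K p] (h : IsSubcoverPolynomial (p ^ e) n s gs)
    {a : K} : a ∈ h.rootGroup ↔ gs.eval a = 0 := Iff.rfl

theorem eq_vanishingPolynomial [Fact p.Prime] [CharP K p] (he : e ≠ 0) (hn : 0 < n)
    (h : IsSubcoverPolynomial (p ^ e) n s gs) [Fintype h.rootGroup] :
    gs = vanishingPolynomial h.rootGroup := by
  classical
  have hnd := nodup_roots (h.separable he hn)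
  have h1 := h.splits.eq_prod_roots_of_monic h.monic
  have h2 : gs.roots = gs.roots.toFinset.val := by
    rw [Multiset.toFinset_val, hnd.dedup]
  rw [h2] at h1
  refine h1.trans ?_
  change ∏ a ∈ gs.roots.toFinset, (X - C a) = _
  rw [vanishingPolynomial]
  exact Finset.prod_subtype _ (fun a => by
    rw [Multiset.mem_toFinset, mem_roots h.monic.ne_zero, mem_rootGroup]; rfl) _

end IsSubcoverPolynomial

end SubcoverPolynomials

/-! ### Coordinate functions as generators of the function field -/

section CoordinateRing

variable {K : Type*} [Field K] {q n r : ℕ} {gs : K[X]}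

theorem degree_curvePolynomial (hgs : gs.Monic) (hpos : 0 < gs.natDegree) :
    (curvePolynomial q n r gs).degree = gs.natDegree := by
  rw [curvePolynomial, degree_sub_eq_left_of_degree_lt, hgs.degree_map,
    degree_eq_natDegree hgs.ne_zero]
  refine lt_of_le_of_lt degree_C_le ?_
  rw [hgs.degree_map, degree_eq_natDegree hgs.ne_zero]
  exact_mod_cast hpos

theorem aeval_xFun (g : K[X]) : aeval (xFun q n r gs) g =
    algebraMap (CoordinateRing q n r gs) _ (AdjoinRoot.of (curvePolynomial q n r gs) g) := by
  induction g using Polynomial.induction_on' with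
  | add a b ha hb => rw [map_add, ha, hb, map_add, map_add]
  | monomial m c =>
    rw [aeval_monomial, xFun, ← C_mul_X_pow_eq_monomial, map_mul, map_mul, map_pow, map_pow]
    rfl

/-- The curve polynomial has positive degree in Y, so K[X] embeds in the coordinate ring. -/
theorem transcendental_xFun [IsDomain (CoordinateRing q n r gs)]
    (hgs : gs.Monic) (hpos : 0 < gs.natDegree) :
    Transcendental K (xFun q n r gs) := by
  rw [transcendental_iff]
  intro g hg
  rw [aeval_xFun] at hg
  have h1 := (IsFractionRing.injective (CoordinateRing q n r gs) (FunctionField q n r gs))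
    (hg.trans (map_zero _).symm)
  exact AdjoinRoot.of.injective_of_degree_ne_zero
    (by rw [degree_curvePolynomial hgs hpos]; exact_mod_cast hpos.ne') (h1.trans (map_zero _).symm)

theorem aeval_yFun : aeval (yFun q n r gs) gs =
    xFun q n r gs ^ (q ^ n + q ^ (n - r)) - xFun q n r gs ^ (q ^ (n - r) + 1) := by
  have h1 : (curvePolynomial q n r gs).eval₂ (AdjoinRoot.of _)
      (AdjoinRoot.root (curvePolynomial q n r gs)) = 0 := AdjoinRoot.eval₂_root _
  rw [curvePolynomial, eval₂_sub, eval₂_C, sub_eq_zero, eval₂_map, ← curvePolynomial] at h1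
  have h2 := congrArg (algebraMap (CoordinateRing q n r gs) (FunctionField q n r gs)) h1
  rw [hom_eval₂] at h2
  refine Eq.trans ?_ (h2.trans ?_)
  · rw [aeval_def]
    rfl
  · simp only [map_sub, map_pow]
    rfl

theorem adjoin_xFun_yFun [IsDomain (CoordinateRing q n r gs)]
    :
    IntermediateField.adjoin K {xFun q n r gs, yFun q n r gs} = ⊤ := by
  rw [eq_top_iff]
  have hmem : ∀ a : CoordinateRing q n r gs, algebraMap _ (FunctionField q n r gs) a ∈
      IntermediateField.adjoin K {xFun q n r gs, yFun q n r gs} := by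
    have hx : xFun q n r gs ∈ IntermediateField.adjoin K {xFun q n r gs, yFun q n r gs} :=
      IntermediateField.subset_adjoin _ _ (by simp)
    have hy : yFun q n r gs ∈ IntermediateField.adjoin K {xFun q n r gs, yFun q n r gs} :=
      IntermediateField.subset_adjoin _ _ (by simp)
    intro a
    induction a using AdjoinRoot.induction_on with
    | ih g =>
      induction g using Polynomial.induction_on' with
      | add a b ha hb =>
        rw [map_add, map_add]
        exact add_mem ha hb
      | monomial m c =>
        rw [← C_mul_X_pow_eq_monomial, map_mul, map_mul, map_pow, map_pow, AdjoinRoot.mk_C,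
          ← aeval_xFun, AdjoinRoot.mk_X]
        refine mul_mem ?_ (pow_mem hy m)
        exact (IntermediateField.algebra_adjoin_le_adjoin K _)
          (Algebra.adjoin_mono (by simp) (aeval_mem_adjoin_singleton K _))
  rintro z -
  obtain ⟨a, b, -, rfl⟩ := IsFractionRing.div_surjective (A := CoordinateRing q n r gs) z
  exact div_mem (hmem a) (hmem b)

end CoordinateRing

theorem exists_place_functionField {K : Type*} [Field K] [Finite K] (V : AddSubgroup K)
    [Fintype V] (p e u r : ℕ) [Fact p.Prime] [CharP K p] (he : e ≠ 0) (hur : u < r)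
    (hV : Nat.card V < (p ^ e) ^ (u + r)) {gs : K[X]} (hgV : gs = vanishingPolynomial V)
    (hgs : gs.Monic) (hpos : 0 < gs.natDegree)
    [IsDomain (CoordinateRing (p ^ e) (u + r) r gs)] :
    ∃ P : Place K (FunctionField (p ^ e) (u + r) r gs), P.IsRational ∧
      (∀ Q : Place K (FunctionField (p ^ e) (u + r) r gs),
        Q.LiesOverInfinity (xFun (p ^ e) (u + r) r gs) (yFun (p ^ e) (u + r) r gs) ↔ Q = P) ∧
      IsPoleDivisor (xFun (p ^ e) (u + r) r gs) (Finsupp.single P (Nat.card V : ℤ)) ∧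
      IsPoleDivisor (yFun (p ^ e) (u + r) r gs)
        (Finsupp.single P (((p ^ e) ^ (u + r) + (p ^ e) ^ u : ℕ) : ℤ)) := by
  have hy := aeval_yFun (q := p ^ e) (n := u + r) (r := r) (gs := gs)
  have hx := transcendental_xFun (q := p ^ e) (n := u + r) (r := r) hgs hpos
  have hgen := adjoin_xFun_yFun (q := p ^ e) (n := u + r) (r := r) (gs := gs)
  generalize xFun (p ^ e) (u + r) r gs = x at *
  generalize yFun (p ^ e) (u + r) r gs = y at *
  rw [Nat.add_sub_cancel] at hy
  subst hgV
  exact exists_place_isPoleDivisor V p e u r he hur hV hx hy hgen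

end SubcoverCurve

end

/-! ### The main theorem -/

theorem lemma3p2 {K : Type*} [Field K] (q n r s : ℕ) (hq : IsPrimePow q)
    (hn : 2 ≤ n) (hr : n ≤ 2 * r) (hrn : r < n) (hnr : Nat.gcd n r = 1)
    (hs : 1 ≤ s) (hsn : s < n - 1) (hK : Nat.card K = q ^ n)
    (gs : Polynomial K) (hgs : SubcoverCurve.IsSubcoverPolynomial q n s gs) :
    ∃ _ : IsDomain (SubcoverCurve.CoordinateRing q n r gs),
    ∃ P : SubcoverCurve.Place K (SubcoverCurve.FunctionField q n r gs),
      P.IsRational ∧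
      (∀ Q : SubcoverCurve.Place K (SubcoverCurve.FunctionField q n r gs),
        Q.LiesOverInfinity (SubcoverCurve.xFun q n r gs) (SubcoverCurve.yFun q n r gs) ↔ Q = P) ∧
      SubcoverCurve.IsPoleDivisor (SubcoverCurve.xFun q n r gs)
        (Finsupp.single P ((q : ℤ) ^ s)) ∧
      SubcoverCurve.IsPoleDivisor (SubcoverCurve.yFun q n r gs)
        (Finsupp.single P ((q : ℤ) ^ n + (q : ℤ) ^ (n - r))) := by
  obtain ⟨p, e, hp, he, rfl⟩ := (isPrimePow_nat_iff q).1 hq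
  have hq1 : 1 < p ^ e := Nat.one_lt_pow he.ne' hp.one_lt
  have : Finite K := Nat.finite_of_card_ne_zero (by rw [hK]; positivity)
  have : Fintype K := Fintype.ofFinite K
  have : Fact p.Prime := ⟨hp⟩
  have : CharP K p := charP_of_card_eq_prime_pow (f := e * n)
    (by rw [← Nat.card_eq_fintype_card, hK, pow_mul])
  obtain ⟨u, rfl⟩ : ∃ u, n = u + r := ⟨n - r, by omega⟩
  -- If u = r, then gcd(n, r) = r = 1 and n = 2, which leaves no s with 1 ≤ s < n - 1.
  have hur : u < r := by
    rcases lt_or_eq_of_le (show u ≤ r by omega) with h | rfl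
    · exact h
    · have : u = 1 := by simpa using hnr
      omega
  let V := hgs.rootGroup
  have : Fintype V := Fintype.ofFinite V
  have hgV : gs = SubcoverCurve.vanishingPolynomial V := hgs.eq_vanishingPolynomial he.ne' (by omega)
  have hcard : Nat.card V = (p ^ e) ^ s := by
    rw [← hgs.natDegree_eq, hgV, SubcoverCurve.vanishingPolynomial.natDegree_eq,
      Nat.card_eq_fintype_card]
  have hpos : 0 < gs.natDegree := by rw [hgs.natDegree_eq]; positivity
  have hirr := SubcoverCurve.irreducible_curvePolynomial V p e u r he.ne' hur
  rw [← hgV] at hirr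
  have hdom : IsDomain (SubcoverCurve.CoordinateRing (p ^ e) (u + r) r gs) :=
    AdjoinRoot.isDomain_of_prime hirr.prime
  refine ⟨hdom, ?_⟩
  obtain ⟨P, h1, h2, h3, h4⟩ := SubcoverCurve.exists_place_functionField V p e u r he.ne' hur
    (by rw [hcard]; exact Nat.pow_lt_pow_right hq1 (by omega)) hgV hgs.monic hpos
  refine ⟨P, h1, h2, ?_, ?_⟩
  · rw [hcard] at h3
    exact_mod_cast h3
  · rw [Nat.add_sub_cancel]
    exact_mod_cast h4
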